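/- Let $R=\mathbb F_2+u\mathbb F_2+u^2\mathbb F_2$ with $u^3=u$, and let $R_w=\mathbb F_2+w\mathbb F_2$ with $w^2=0$. Identify $R$ with $\mathbb F_2\times R_w$ by the Chinese remainder isomorphism $a+ub+u^2c\mapsto (a,\ (a+b+c)+bw)$. For linear codes $C_2\subseteq\mathbb F_2^n$ and $C_w\subseteq R_w^n$, let $\mathrm{CRT}^{-1}(C_2,C_w)\subseteq R^n$ be the linear code of all words whose coordinatewise images lie in $C_2$ and in $C_w$. A linear code $C\subseteq R^n$ is of type $8^{k_1}4^{k_2}4^{k_3}2^{k_4}2^{k_5}$ if, as an $R$-module, $$C\cong R^{k_1}\oplus\langle u\rangle^{k_2}\oplus\langle 1+u\rangle^{k_3}\oplus\langle 1+u^2\rangle^{k_4}\oplus\langle u+u^2\rangle^{k_5}$$ (so that $|C|=2^{3k_1+2k_2+2k_3+k_4+k_5}$). The Gray map $\Phi:R^n\to\mathbb F_2^{3n}$ replaces each coordinate $a+ub+u^2c$ by $(a,a+c,b)$; the Lee weight of a word is the Hamming weight of its Gray image, and the Lee distance of two words is the Lee weight of their difference. Duals are taken with respect to $x\cdot y=\sum_i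 x_iy_i$. A quantum code with parameters $[[N,K,d]]$ is a $2^K$-dimensional subspace $Q$ of $(\mathbb C^2)^{\otimes N}$ with minimum distance $d$: it detects every Pauli error $E$ of weight less than $d$ (that is, $PEP$ is a scalar multiple of $P$, where $P$ is the orthogonal projection onto $Q$), but not every Pauli error of weight $d$. If only the first property is required, the parameters are written $[[N,K,\ge d]]$. **Theorem.** Let $C=\mathrm{CRT}^{-1}(C_2,C_w)$ be a cyclic code of odd length $n$ over $R$ of type $8^{k_1}4^{k_2}4^{k_3}2^{k_4}2^{k_5}$, and let $d_L$ be the minimum Lee distance of $C$. If $C_2^\perp\subseteq C_2$ and $C_w^\perp\subseteq C_w$, then $C^\perp\subseteq C$. Moreover, with $$K=6k_1+4(k_2+k_3)+2(k_4+k_5)-3n\ \ge 0,$$ the following hold. 1. $\Phi(C)^\perp\subseteq\Phi(C)$, and the CSS code of $\Phi(C)$, i.e. the span of the states $\sum_{y\in\Phi(C)^\perp}|x+y\rangle$ with $x\in\Phi(C)$, is a quantum code with parameters $[[3n,K,\ge d_L]]$. 2. There exists a quantum code with parameters $[[3n,K,d_L]]$. -/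

import Mathlib

namespace CyclicQuantum

open scoped DualNumber

noncomputable section

/-- The ring `F₂ + u F₂ + u² F₂` with `u³ = u`; `⟨a, b, c⟩` stands for `a + u b + u² c`. -/
@[ext]
structure R where
  a : ZMod 2
  b : ZMod 2
  c : ZMod 2

namespace R

instance : Zero R := ⟨⟨0, 0, 0⟩⟩
instance : One R := ⟨⟨1, 0, 0⟩⟩
instance : Add R := ⟨fun x y => ⟨x.a + y.a, x.b + y.b, x.c + y.c⟩⟩
instance : Neg R := ⟨fun x => ⟨-x.a, -x.b, -x.c⟩⟩
/-- Multiplication of polynomials in `u`, reduced with `u³ = u` and `u⁴ = u²`. -/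
instance : Mul R := ⟨fun x y =>
  ⟨x.a * y.a,
   x.a * y.b + x.b * y.a + x.b * y.c + x.c * y.b,
   x.a * y.c + x.b * y.b + x.c * y.a + x.c * y.c⟩⟩

@[simp] theorem zero_a : (0 : R).a = 0 := rfl
@[simp] theorem zero_b : (0 : R).b = 0 := rfl
@[simp] theorem zero_c : (0 : R).c = 0 := rfl
@[simp] theorem one_a : (1 : R).a = 1 := rfl
@[simp] theorem one_b : (1 : R).b = 0 := rfl
@[simp] theorem one_c : (1 : R).c = 0 := rfl
@[simp] theorem add_a (x y : R) : (x + y).a = x.a + y.a := rfl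
@[simp] theorem add_b (x y : R) : (x + y).b = x.b + y.b := rfl
@[simp] theorem add_c (x y : R) : (x + y).c = x.c + y.c := rfl
@[simp] theorem neg_a (x : R) : (-x).a = -x.a := rfl
@[simp] theorem neg_b (x : R) : (-x).b = -x.b := rfl
@[simp] theorem neg_c (x : R) : (-x).c = -x.c := rfl
@[simp] theorem mul_a (x y : R) : (x * y).a = x.a * y.a := rfl
@[simp] theorem mul_b (x y : R) :
    (x * y).b = x.a * y.b + x.b * y.a + x.b * y.c + x.c * y.b := rfl
@[simp] theorem mul_c (x y : R) :
    (x * y).c = x.a * y.c + x.b * y.b + x.c * y.a + x.c * y.c := rfl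

instance : CommRing R where
  add_assoc x y z := by ext <;> simp <;> ring
  zero_add x := by ext <;> simp
  add_zero x := by ext <;> simp
  add_comm x y := by ext <;> simp <;> ring
  left_distrib x y z := by ext <;> simp <;> ring
  right_distrib x y z := by ext <;> simp <;> ring
  zero_mul x := by ext <;> simp
  mul_zero x := by ext <;> simp
  mul_assoc x y z := by ext <;> simp <;> ring
  one_mul x := by ext <;> simp
  mul_one x := by ext <;> simp
  mul_comm x y := by ext <;> simp <;> ring
  neg_add_cancel x := by ext <;> exact neg_add_cancel _
  nsmul := nsmulRec
  zsmul := zsmulRec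

/-- The element `u`. -/
def u : R := ⟨0, 1, 0⟩

theorem u_pow_three : u ^ 3 = u := by
  rw [pow_succ, pow_two]; ext <;> simp [u]

/-- The Chinese remainder isomorphism `R ≃ F₂ × (F₂ + w F₂)`, `w² = 0`,
`a + u b + u² c ↦ (a, (a + b + c) + b w)`, with inverse
`(a, A + B w) ↦ a + B u + (a + A + B) u²`. The ring `F₂ + w F₂` is the ring of dual numbers. -/
def crt : R ≃+* ZMod 2 × (ZMod 2)[ε] where
  toFun x := (x.a, TrivSqZeroExt.inl (x.a + x.b + x.c) + TrivSqZeroExt.inr x.b)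
  invFun p := ⟨p.1, p.2.snd, p.1 + p.2.fst + p.2.snd⟩
  left_inv x := by
    ext
    · simp
    · simp
    · have h : ∀ a b c : ZMod 2, a + (a + b + c) + b = c := by decide
      simpa using h x.a x.b x.c
  right_inv p := by
    have h : ∀ a b c : ZMod 2, a + c + (a + b + c) = b := by decide
    ext
    · simp
    · simpa using h p.1 p.2.fst p.2.snd
    · simp
  map_mul' x y := by
    have h : ∀ a b c a' b' c' : ZMod 2,
        a * a' + (a * b' + b * a' + b * c' + c * b') + (a * c' + b * b' + c * a' + c * c')
          = (a + b + c) * (a' + b' + c') := by decide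
    have h' : ∀ a b c a' b' c' : ZMod 2,
        a * b' + b * a' + b * c' + c * b' = (a + b + c) * b' + b * (a' + b' + c') := by decide
    ext
    · simp
    · simpa using h x.a x.b x.c y.a y.b y.c
    · simpa using h' x.a x.b x.c y.a y.b y.c
  map_add' x y := by
    ext
    · simp
    · simp; ring
    · simp

/-- The Gray map on `R`: `a + u b + u² c ↦ (a, a + c, b)`. -/
def gray (x : R) : Fin 3 → ZMod 2 := ![x.a, x.a + x.c, x.b]

/-- The Lee weight of an element of `R`: the Hamming weight of its Gray image. -/
def leeWeight (x : R) : ℕ := hammingNorm x.gray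

end R

/-! ### Linear codes -/

/-- The Euclidean dual of a linear code. -/
def dualCode {S ι : Type*} [CommRing S] [Fintype ι] (C : Submodule S (ι → S)) :
    Submodule S (ι → S) where
  carrier := {x | ∀ y ∈ C, x ⬝ᵥ y = 0}
  add_mem' {x x'} hx hx' y hy := by rw [add_dotProduct, hx y hy, hx' y hy, add_zero]
  zero_mem' y _ := zero_dotProduct y
  smul_mem' r x hx y hy := by rw [smul_dotProduct, hx y hy, smul_zero]

/-- Invariance under the shift `(c₀, …, cₙ₋₁) ↦ (cₙ₋₁, c₀, …, cₙ₋₂)`. -/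
def IsCyclicCode {S : Type*} [CommRing S] {n : ℕ} (C : Submodule S (Fin n → S)) : Prop :=
  ∀ c ∈ C, (fun i => c ((finRotate n).symm i)) ∈ C

/-- The code `CRT⁻¹(C₂, C_w)` over `R`: the words whose coordinatewise residues lie in
`C₂` and in `C_w`. -/
def crtCode {n : ℕ} (C₂ : Submodule (ZMod 2) (Fin n → ZMod 2))
    (Cw : Submodule (ZMod 2)[ε] (Fin n → (ZMod 2)[ε])) : Submodule R (Fin n → R) where
  carrier := {x | (fun i => (R.crt (x i)).1) ∈ C₂ ∧ (fun i => (R.crt (x i)).2) ∈ Cw}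
  add_mem' {x y} hx hy := by
    constructor
    · simpa [Pi.add_def] using C₂.add_mem hx.1 hy.1
    · simpa [Pi.add_def] using Cw.add_mem hx.2 hy.2
  zero_mem' := by
    constructor
    · simpa [Pi.zero_def] using C₂.zero_mem
    · simpa [Pi.zero_def] using Cw.zero_mem
  smul_mem' r x hx := by
    constructor
    · simpa [Pi.smul_def] using C₂.smul_mem (R.crt r).1 hx.1
    · simpa [Pi.smul_def] using Cw.smul_mem (R.crt r).2 hx.2

/-- `C` has type `8^k₁ 4^k₂ 4^k₃ 2^k₄ 2^k₅`: as an `R`-module it is a direct sum of cyclic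
modules, `k₁` copies of `R` (8 elements) and `k₂`, `k₃`, `k₄`, `k₅` copies of the ideals
`⟨u⟩` (4 elements), `⟨1 + u⟩` (4 elements), `⟨1 + u²⟩` (2 elements), `⟨u + u²⟩` (2 elements). -/
def HasType {n : ℕ} (C : Submodule R (Fin n → R)) (k₁ k₂ k₃ k₄ k₅ : ℕ) : Prop :=
  Nonempty (C ≃ₗ[R]
    (Fin k₁ → R) ×
    (Fin k₂ → Ideal.span {R.u}) ×
    (Fin k₃ → Ideal.span {1 + R.u}) ×
    (Fin k₄ → Ideal.span {1 + R.u ^ 2}) ×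
    (Fin k₅ → Ideal.span {R.u + R.u ^ 2}))

/-- The Lee distance on `Rⁿ`. -/
def leeDist {n : ℕ} (x y : Fin n → R) : ℕ := ∑ i, (x i - y i).leeWeight

/-- The minimum Lee distance between distinct codewords. -/
def minLeeDist {n : ℕ} (C : Submodule R (Fin n → R)) : ℕ :=
  sInf {d | ∃ x ∈ C, ∃ y ∈ C, x ≠ y ∧ d = leeDist x y}

/-- The Gray map `Rⁿ → F₂³ⁿ`,
`(x₀, …, xₙ₋₁) ↦ (a₀, a₀ + c₀, b₀, …, aₙ₋₁, aₙ₋₁ + cₙ₋₁, bₙ₋₁)`. -/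
def grayMap {n : ℕ} (x : Fin n → R) : Fin (3 * n) → ZMod 2 := fun j =>
  (x ⟨j / 3, Nat.div_lt_of_lt_mul j.isLt⟩).gray ⟨j % 3, Nat.mod_lt _ (by norm_num)⟩

theorem grayMap_add {n : ℕ} (x y : Fin n → R) : grayMap (x + y) = grayMap x + grayMap y := by
  have h : ∀ (p q : R) (k : Fin 3), (p + q).gray k = p.gray k + q.gray k := by
    intro p q k
    fin_cases k
    · simp [R.gray]
    · simp [R.gray]; ring
    · simp [R.gray]
  funext j
  exact h _ _ _

theorem grayMap_zero {n : ℕ} : grayMap (0 : Fin n → R) = 0 := by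
  have h := grayMap_add (0 : Fin n → R) 0
  simpa using h

/-- The Gray image of a linear code over `R`, a binary linear code. -/
def grayCode {n : ℕ} (C : Submodule R (Fin n → R)) :
    Submodule (ZMod 2) (Fin (3 * n) → ZMod 2) where
  carrier := grayMap '' C
  add_mem' := by
    rintro _ _ ⟨x, hx, rfl⟩ ⟨y, hy, rfl⟩
    exact ⟨x + y, C.add_mem hx hy, grayMap_add x y⟩
  zero_mem' := ⟨0, C.zero_mem, grayMap_zero⟩
  smul_mem' := by
    rintro r _ ⟨x, hx, rfl⟩
    have hr : r = 0 ∨ r = 1 := by revert r; decide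
    rcases hr with rfl | rfl
    · exact ⟨0, C.zero_mem, by rw [grayMap_zero, zero_smul]⟩
    · exact ⟨x, hx, by rw [one_smul]⟩

/-! ### Quantum codes on qubits indexed by a finite type -/

section Quantum

variable {ι : Type*} [Fintype ι] [DecidableEq ι]

/-- The state space of the qubits, with orthonormal basis `|x⟩`, `x ∈ F₂^ι`. -/
abbrev Qubits (ι : Type*) [Fintype ι] [DecidableEq ι] : Type _ := EuclideanSpace ℂ (ι → ZMod 2)

/-- The Pauli operator `X^a Z^b`, which maps `|x⟩` to `(-1)^(b·x) |x + a⟩`. -/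
def pauli (a b : ι → ZMod 2) (ψ : Qubits ι) : Qubits ι :=
  WithLp.toLp 2 fun z => (-1 : ℂ) ^ (b ⬝ᵥ (z - a)).val * ψ (z - a)

/-- The weight of `X^a Z^b`: the number of qubits on which it is not the identity. -/
def pauliWeight (a b : ι → ZMod 2) : ℕ :=
  (Finset.univ.filter fun i => a i ≠ 0 ∨ b i ≠ 0).card

/-- The Knill–Laflamme condition: `Q` detects the error `X^a Z^b`, that is,
`P E P` is a multiple of the orthogonal projection `P` onto `Q`. -/
def Detects (Q : Submodule ℂ (Qubits ι)) (a b : ι → ZMod 2) : Prop :=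
  ∃ l : ℂ, ∀ φ ∈ Q, ∀ ψ ∈ Q, inner ℂ φ (pauli a b ψ) = l * inner ℂ φ ψ

/-- `Q` encodes `K` qubits and detects every error of weight less than `d`
(minimum distance at least `d`). -/
def IsQuantumCode (Q : Submodule ℂ (Qubits ι)) (K d : ℕ) : Prop :=
  Module.finrank ℂ Q = 2 ^ K ∧ ∀ a b : ι → ZMod 2, pauliWeight a b < d → Detects Q a b

/-- `Q` encodes `K` qubits and has minimum distance exactly `d`. -/
def IsExactQuantumCode (Q : Submodule ℂ (Qubits ι)) (K d : ℕ) : Prop :=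
  IsQuantumCode Q K d ∧ ∃ a b : ι → ZMod 2, pauliWeight a b = d ∧ ¬ Detects Q a b

/-- The (unnormalized) coset state `∑_{y ∈ B} |x + y⟩`. -/
def cosetState (B : Submodule (ZMod 2) (ι → ZMod 2)) (x : ι → ZMod 2) : Qubits ι :=
  open Classical in WithLp.toLp 2 fun z => if z - x ∈ B then (1 : ℂ) else 0

/-- The CSS code of a pair of binary codes `B ⊆ A`: the span of the states
`∑_{y ∈ B} |x + y⟩`, `x ∈ A`. -/
def cssCode (A B : Submodule (ZMod 2) (ι → ZMod 2)) : Submodule ℂ (Qubits ι) :=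
  Submodule.span ℂ (cosetState B '' A)

end Quantum

end

end CyclicQuantum

open CyclicQuantum
open scoped DualNumber

/-! The binary dot product of two Gray images is the `u²`-coefficient of the dot product over `R`.
That coefficient generates the dual of `R`, so the Gray map carries duals to duals
(`dualCode_grayCode`). It also turns Lee distance into Hamming distance. Since duality splits along
the CRT (`dualCode_crtCode_le`), `A = Φ(C)` contains its dual, and the CSS argument
(`isQuantumCode_cssCode_dualCode`) gives the first code. Its dimension comes from `|A| = |C|`.

The CSS distance may exceed `d_L`, because a minimum weight word of `A` may lie in `A^⊥` and act
trivially. An exact code is obtained by degrading it. As `3n` is odd, `A ≠ A^⊥`, so some `X^x` with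
`x ∈ A \ A^⊥` goes undetected. CNOT gates shrink `x`, each lowering the distance by at most one, so
a code of distance exactly `d_L` is met on the way (`IsQuantumCode.exists_isExactQuantumCode`). -/

namespace CyclicQuantum

/-! ### CNOT gates on binary words -/

section Cnot

variable {ι : Type*} [DecidableEq ι]

/-- The action on `F₂^ι` of the CNOT gate with control `i` and target `j`. -/
def cnot (i j : ι) (x : ι → ZMod 2) : ι → ZMod 2 := x + Pi.single j (x i)

theorem cnot_sub (i j : ι) (x y : ι → ZMod 2) : cnot i j (x - y) = cnot i j x - cnot i j y := by
  simp only [cnot, Pi.sub_apply, Pi.single_sub]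
  abel

theorem cnot_apply_target (i j : ι) (x : ι → ZMod 2) : cnot i j x j = x j + x i := by
  simp [cnot]

theorem cnot_apply_of_ne {i j k : ι} (h : k ≠ j) (x : ι → ZMod 2) : cnot i j x k = x k := by
  simp [cnot, h]

theorem cnot_involutive {i j : ι} (h : i ≠ j) :
    Function.Involutive (cnot i j) := by
  intro x
  ext k
  by_cases hk : k = j
  · subst hk
    rw [cnot_apply_target, cnot_apply_target, cnot_apply_of_ne h, add_assoc,
      CharTwo.add_self_eq_zero, add_zero]
  · rw [cnot_apply_of_ne hk, cnot_apply_of_ne hk]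

theorem exists_support_pair {ι : Type*} [Fintype ι] {x : ι → ZMod 2}
    (h : 1 < pauliWeight x 0) : ∃ i j, i ≠ j ∧ x i ≠ 0 ∧ x j ≠ 0 := by
  obtain ⟨i, hi, j, hj, hij⟩ := Finset.one_lt_card.1 h
  exact ⟨i, j, hij, by simpa using hi, by simpa using hj⟩

end Cnot

/-! ### Pauli operators and equivalence of quantum codes under CNOT gates -/

section Quantum

variable {ι : Type*} [Fintype ι] [DecidableEq ι]

theorem neg_one_pow_val_add (s t : ZMod 2) :
    (-1 : ℂ) ^ (s + t).val = (-1) ^ s.val * (-1) ^ t.val := by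
  have h : ∀ r : ZMod 2, r = 0 ∨ r = 1 := by decide
  have h2 : (1 + 1 : ZMod 2) = 0 := by decide
  rcases h s with rfl | rfl <;> rcases h t with rfl | rfl <;> simp [h2, ZMod.val_one]

theorem inner_pauli (a b : ι → ZMod 2) (φ ψ : Qubits ι) :
    inner ℂ φ (pauli a b ψ) =
      ∑ z, (-1 : ℂ) ^ (b ⬝ᵥ (z - a)).val * ψ (z - a) * (starRingEnd ℂ) (φ z) := by
  simp [PiLp.inner_apply, pauli]

theorem pauli_zero_zero (ψ : Qubits ι) : pauli 0 0 ψ = ψ := by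
  ext z
  simp [pauli]

/-- Transposing a CNOT swaps control and target; hence phase errors propagate from target to
control. -/
theorem dotProduct_cnot (i j : ι) (b x : ι → ZMod 2) : b ⬝ᵥ cnot i j x = cnot j i b ⬝ᵥ x := by
  simp [cnot, dotProduct_add, add_dotProduct]

/-- The CNOT gate as a unitary operator. -/
noncomputable def cnotGate {i j : ι} (h : i ≠ j) : Qubits ι ≃ₗᵢ[ℂ] Qubits ι :=
  LinearIsometryEquiv.piLpCongrLeft 2 ℂ ℂ (cnot_involutive h).toPerm

theorem cnotGate_apply {i j : ι} (h : i ≠ j) (ψ : Qubits ι) (z : ι → ZMod 2) :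
    cnotGate h ψ z = ψ (cnot i j z) := rfl

theorem inner_cnotGate_pauli {i j : ι} (h : i ≠ j) (a b : ι → ZMod 2) (φ ψ : Qubits ι) :
    inner ℂ (cnotGate h φ) (pauli a b (cnotGate h ψ)) =
      inner ℂ φ (pauli (cnot i j a) (cnot j i b) ψ) := by
  rw [inner_pauli, inner_pauli, 
    ← Equiv.sum_comp (cnot_involutive h).toPerm]
  refine Finset.sum_congr rfl fun z _ => ?_
  simp only [cnotGate_apply, Function.Involutive.coe_toPerm, cnot_sub, cnot_involutive h z,
    ← dotProduct_cnot, cnot_involutive h a]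

theorem detects_map_cnotGate {i j : ι} (h : i ≠ j) (Q : Submodule ℂ (Qubits ι))
    (a b : ι → ZMod 2) :
    Detects (Q.map (cnotGate h).toLinearEquiv.toLinearMap) a b ↔
      Detects Q (cnot i j a) (cnot j i b) := by
  refine exists_congr fun l => ?_
  constructor
  · intro H φ hφ ψ hψ
    have := H _ (Submodule.mem_map_of_mem hφ) _ (Submodule.mem_map_of_mem hψ)
    rw [← inner_cnotGate_pauli h]
    refine this.trans ?_
    congr 1
    exact (cnotGate h).inner_map_map φ ψ
  · rintro H _ ⟨φ, hφ, rfl⟩ _ ⟨ψ, hψ, rfl⟩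
    refine (inner_cnotGate_pauli h a b φ ψ).trans ((H φ hφ ψ hψ).trans ?_)
    congr 1
    exact ((cnotGate h).inner_map_map φ ψ).symm

theorem pauliWeight_cnot_le (i j : ι) (a b : ι → ZMod 2) :
    pauliWeight (cnot i j a) (cnot j i b) ≤ pauliWeight a b + 1 := by
  unfold pauliWeight
  set S := Finset.univ.filter fun k => a k ≠ 0 ∨ b k ≠ 0 with hS
  have hsub : (Finset.univ.filter fun k => cnot i j a k ≠ 0 ∨ cnot j i b k ≠ 0) ⊆
      insert i (insert j S) := by
    intro k hk
    by_cases hi : k = i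
    · simp [hi]
    by_cases hj : k = j
    · simp [hj]
    simpa [hi, hj, hS, cnot_apply_of_ne] using hk
  by_cases hi : i ∈ S
  · rw [Finset.insert_comm, Finset.insert_eq_of_mem hi] at hsub
    exact (Finset.card_le_card hsub).trans (Finset.card_insert_le _ _)
  by_cases hj : j ∈ S
  · rw [Finset.insert_eq_of_mem hj] at hsub
    exact (Finset.card_le_card hsub).trans (Finset.card_insert_le _ _)
  -- With both qubits outside the support, neither control bit is set, so the error is unchanged.
  simp only [hS, Finset.mem_filter, Finset.mem_univ, true_and, not_or, not_not] at hi hj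
  have ha : cnot i j a = a := by simp [cnot, hi.1]
  have hb : cnot j i b = b := by simp [cnot, hj.2]
  rw [ha, hb]
  exact Nat.le_succ _

theorem pauliWeight_cnot_lt {i j : ι} (h : i ≠ j) {x : ι → ZMod 2} (hi : x i ≠ 0) (hj : x j ≠ 0) :
    pauliWeight (cnot i j x) 0 < pauliWeight x 0 := by
  have h1 : ∀ r : ZMod 2, r ≠ 0 → r = 1 := by decide
  have hz : cnot i j x j = 0 := by
    rw [cnot_apply_target, h1 _ hi, h1 _ hj]; decide
  apply Finset.card_lt_card
  rw [Finset.ssubset_iff_of_subset]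
  · exact ⟨j, by simp [hj], by simp [hz]⟩
  · intro k hk
    by_cases hkj : k = j
    · subst hkj; simp [hj]
    · simpa [cnot_apply_of_ne hkj] using hk

/-- A quantum code of distance at least `d ≥ 1` that fails to detect some bit-flip error `X^x` can be
transformed by CNOT gates into a code of the same dimension and distance exactly `d`. Each gate
changes the weight of a Pauli error by at most one, and the gates are chosen to shrink the support
of `x`. -/
theorem IsQuantumCode.exists_isExactQuantumCode {K d : ℕ} (hd : 1 ≤ d)
    {Q : Submodule ℂ (Qubits ι)} (hQ : IsQuantumCode Q K d)
    {x : ι → ZMod 2} (hx : ¬ Detects Q x 0) :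
    ∃ Q' : Submodule ℂ (Qubits ι), IsExactQuantumCode Q' K d := by
  induction hm : pauliWeight x 0 using Nat.strong_induction_on generalizing Q x with
  | _ m ih =>
    subst hm
    by_cases hex : ∃ a b : ι → ZMod 2, pauliWeight a b = d ∧ ¬ Detects Q a b
    · exact ⟨Q, hQ, hex⟩
    push Not at hex
    have hlt : d < pauliWeight x 0 := by
      by_contra hle
      rcases (not_lt.1 hle).lt_or_eq with h | h
      · exact hx (hQ.2 _ _ h)
      · exact hx (hex _ _ h)
    -- Here `1 ≤ d` is needed: `x` must have two support points to cancel one against the other.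
    obtain ⟨i, j, hij, hi, hj⟩ := exists_support_pair (lt_of_le_of_lt hd hlt)
    refine ih _ (pauliWeight_cnot_lt hij hi hj)
      (Q := Q.map (cnotGate hij).toLinearEquiv.toLinearMap) ⟨?_, fun a b hab => ?_⟩ ?_ rfl
    · rw [LinearEquiv.finrank_map_eq]; exact hQ.1
    · rw [detects_map_cnotGate]
      have := pauliWeight_cnot_le i j a b
      -- The current code detects weight `d` as well, which absorbs the possible increase by one.
      rcases (show pauliWeight (cnot i j a) (cnot j i b) ≤ d by omega).lt_or_eq with h | h
      · exact hQ.2 _ _ h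
      · exact hex _ _ h
    · rw [detects_map_cnotGate, cnot_involutive hij]
      simpa [cnot] using hx

/-! ### CSS codes -/

theorem cosetState_apply_of_mem {B : Submodule (ZMod 2) (ι → ZMod 2)} {x z : ι → ZMod 2}
    (h : z - x ∈ B) : cosetState B x z = 1 := by
  simp [cosetState, h]

theorem cosetState_apply_of_notMem {B : Submodule (ZMod 2) (ι → ZMod 2)} {x z : ι → ZMod 2}
    (h : z - x ∉ B) : cosetState B x z = 0 := by
  simp [cosetState, h]

theorem cosetState_apply_congr {B : Submodule (ZMod 2) (ι → ZMod 2)} {x y z t : ι → ZMod 2}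
    (h : z - x ∈ B ↔ t - y ∈ B) : cosetState B x z = cosetState B y t := by
  by_cases hz : z - x ∈ B
  · rw [cosetState_apply_of_mem hz, cosetState_apply_of_mem (h.1 hz)]
  · rw [cosetState_apply_of_notMem hz, cosetState_apply_of_notMem (mt h.2 hz)]

theorem cosetState_eq_of_sub_mem {B : Submodule (ZMod 2) (ι → ZMod 2)} {x y : ι → ZMod 2}
    (h : x - y ∈ B) : cosetState B x = cosetState B y := by
  ext z
  have : z - x ∈ B ↔ z - y ∈ B := by
    rw [← sub_add_sub_cancel z x y, B.add_mem_iff_left h]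
  exact cosetState_apply_congr this

theorem cosetState_ne_zero (B : Submodule (ZMod 2) (ι → ZMod 2)) (x : ι → ZMod 2) :
    cosetState B x ≠ 0 := by
  intro h
  have h1 : cosetState B x x = 1 := cosetState_apply_of_mem (by simp)
  simp [h] at h1

theorem inner_cosetState_eq_zero {B : Submodule (ZMod 2) (ι → ZMod 2)} {x y : ι → ZMod 2}
    (h : x - y ∉ B) : inner ℂ (cosetState B x) (cosetState B y) = 0 := by
  rw [PiLp.inner_apply]
  refine Finset.sum_eq_zero fun z _ => ?_
  by_cases hx : z - x ∈ B
  · have hy : z - y ∉ B := fun hy => h (by simpa using B.sub_mem hy hx)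
    rw [cosetState_apply_of_notMem hy]; simp
  · rw [cosetState_apply_of_notMem hx]; simp

theorem pauli_cosetState (B : Submodule (ZMod 2) (ι → ZMod 2)) (a x : ι → ZMod 2) :
    pauli a 0 (cosetState B x) = cosetState B (x + a) := by
  ext z
  have : pauli a 0 (cosetState B x) z = cosetState B x (z - a) := by simp [pauli]
  rw [this]
  exact cosetState_apply_congr (by rw [sub_sub, add_comm])

variable {A B : Submodule (ZMod 2) (ι → ZMod 2)}

theorem apply_eq_zero_of_mem_cssCode (hBA : B ≤ A) {ψ : Qubits ι} (hψ : ψ ∈ cssCode A B)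
    {z : ι → ZMod 2} (hz : z ∉ A) : ψ z = 0 := by
  induction hψ using Submodule.span_induction with
  | mem ψ h =>
    obtain ⟨x, hx, rfl⟩ := h
    exact cosetState_apply_of_notMem fun h => hz (by simpa using A.add_mem (hBA h) hx)
  | zero => rfl
  | add φ ψ _ _ hφ hψ => simp [hφ, hψ]
  | smul c ψ _ hψ => simp [hψ]

theorem apply_add_of_mem_cssCode {ψ : Qubits ι} (hψ : ψ ∈ cssCode A B)
    {y : ι → ZMod 2} (hy : y ∈ B) (z : ι → ZMod 2) : ψ (z + y) = ψ z := by
  induction hψ using Submodule.span_induction with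
  | mem ψ h =>
    obtain ⟨x, hx, rfl⟩ := h
    have : z + y - x ∈ B ↔ z - x ∈ B := by
      rw [add_sub_right_comm, B.add_mem_iff_left hy]
    exact cosetState_apply_congr this
  | zero => rfl
  | add φ ψ _ _ hφ hψ => simp [hφ, hψ]
  | smul c ψ _ hψ => simp [hψ]

/-- Code states are supported on `A`, and `X^a` moves them to the disjoint coset `A + a`. -/
theorem detects_cssCode_of_notMem (hBA : B ≤ A) {a : ι → ZMod 2} (ha : a ∉ A)
    (b : ι → ZMod 2) : Detects (cssCode A B) a b := by
  refine ⟨0, fun φ hφ ψ hψ => ?_⟩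
  rw [inner_pauli, zero_mul]
  refine Finset.sum_eq_zero fun z _ => ?_
  by_cases hz : z ∈ A
  · have : z - a ∉ A := fun h => ha (by simpa using A.sub_mem hz h)
    rw [apply_eq_zero_of_mem_cssCode hBA hψ this]; simp
  · rw [apply_eq_zero_of_mem_cssCode hBA hφ hz]; simp

theorem detects_cssCode_of_notMem_dualCode (a : ι → ZMod 2) {b : ι → ZMod 2}
    (hb : b ∉ dualCode B) : Detects (cssCode A B) a b := by
  obtain ⟨y, hy, hby⟩ : ∃ y ∈ B, b ⬝ᵥ y ≠ 0 := by
    by_contra! h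
    exact hb h
  have h1 : ∀ r : ZMod 2, r ≠ 0 → r = 1 := by decide
  refine ⟨0, fun φ hφ ψ hψ => ?_⟩
  -- Code states are invariant under translation by `y`, while the phase changes sign because `b ⬝ᵥ
  -- y = 1`; so the sum is its own negative.
  rw [inner_pauli, zero_mul, ← self_eq_neg, ← Finset.sum_neg_distrib,
    ← Equiv.sum_comp (Equiv.addRight y)]
  refine Finset.sum_congr rfl fun z _ => ?_
  rw [Equiv.coe_addRight, add_sub_right_comm, apply_add_of_mem_cssCode hψ hy,
    apply_add_of_mem_cssCode hφ hy, dotProduct_add, neg_one_pow_val_add, h1 _ hby, ZMod.val_one]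
  ring

/-- `X^x` sends the coset state of `0` to that of `x`, which is an orthogonal code state: a
nontrivial logical operator. -/
theorem not_detects_cssCode {x : ι → ZMod 2} (hxA : x ∈ A) (hxB : x ∉ B) :
    ¬ Detects (cssCode A B) x 0 := by
  rintro ⟨l, hl⟩
  have h0 : cosetState B 0 ∈ cssCode A B := Submodule.subset_span ⟨0, A.zero_mem, rfl⟩
  have hx : cosetState B x ∈ cssCode A B := Submodule.subset_span ⟨x, hxA, rfl⟩
  have e := hl _ hx _ h0
  rw [pauli_cosetState, zero_add, inner_cosetState_eq_zero (x := x) (y := 0) (by simpa using hxB),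
    mul_zero,
    inner_self_eq_zero] at e
  exact cosetState_ne_zero B x e

/-- The coset states indexed by `A ⧸ B` have disjoint supports, hence form an orthogonal basis. -/
theorem finrank_cssCode (hBA : B ≤ A) :
    Module.finrank ℂ (cssCode A B) =
      2 ^ (Module.finrank (ZMod 2) A - Module.finrank (ZMod 2) B) := by
  classical
  set B' := B.submoduleOf A with hB'
  let v : A ⧸ B' → Qubits ι := fun q => cosetState B (q.out : A)
  have hv : ∀ x : A, v (Submodule.Quotient.mk x) = cosetState B x := by
    intro x
    refine cosetState_eq_of_sub_mem ?_
    have : (Submodule.Quotient.mk (Quotient.out (Submodule.Quotient.mk x : A ⧸ B')) : A ⧸ B') =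
      Submodule.Quotient.mk x := Quotient.out_eq _
    exact (Submodule.Quotient.eq B').1 this
  have hli : LinearIndependent ℂ v := by
    refine linearIndependent_of_ne_zero_of_inner_eq_zero (fun q => cosetState_ne_zero B _) ?_
    intro p q hpq
    obtain ⟨x, rfl⟩ := Submodule.Quotient.mk_surjective B' p
    obtain ⟨y, rfl⟩ := Submodule.Quotient.mk_surjective B' q
    rw [hv, hv]
    exact inner_cosetState_eq_zero fun h => hpq ((Submodule.Quotient.eq B').2 h)
  have hspan : cssCode A B = Submodule.span ℂ (Set.range v) := by
    unfold cssCode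
    congr 1
    ext ψ
    constructor
    · rintro ⟨x, hx, rfl⟩
      exact ⟨Submodule.Quotient.mk ⟨x, hx⟩, hv ⟨x, hx⟩⟩
    · rintro ⟨q, rfl⟩
      exact ⟨_, (q.out : A).2, rfl⟩
  have : Fintype (A ⧸ B') := Fintype.ofFinite _
  rw [hspan, finrank_span_eq_card hli, Module.card_eq_pow_finrank (K := ZMod 2), ZMod.card,
    Submodule.finrank_quotient, LinearEquiv.finrank_eq (Submodule.submoduleOfEquivOfLe hBA)]

end Quantum

/-! ### Duality of binary codes -/

section Duality

variable {ι : Type*} [Fintype ι]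

theorem dualCode_eq_orthogonal (A : Submodule (ZMod 2) (ι → ZMod 2)) :
    dualCode A = LinearMap.BilinForm.orthogonal
      (dotProductBilin (ZMod 2) (ZMod 2) : LinearMap.BilinForm (ZMod 2) (ι → ZMod 2)) A := by
  ext x
  rw [LinearMap.BilinForm.mem_orthogonal_iff]
  refine forall₂_congr fun y _ => ?_
  rw [dotProduct_comm]
  rfl

theorem dotProductBilin_nondegenerate : LinearMap.BilinForm.Nondegenerate
    (dotProductBilin (ZMod 2) (ZMod 2) : LinearMap.BilinForm (ZMod 2) (ι → ZMod 2)) := by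
  refine ⟨fun x hx => ?_, fun x hx => ?_⟩
  · exact dotProduct_eq_zero x hx
  · exact dotProduct_eq_zero x fun y => (dotProduct_comm x y).trans (hx y)

theorem finrank_dualCode (A : Submodule (ZMod 2) (ι → ZMod 2)) :
    Module.finrank (ZMod 2) (dualCode A) = Fintype.card ι - Module.finrank (ZMod 2) A := by
  rw [dualCode_eq_orthogonal, LinearMap.BilinForm.finrank_orthogonal dotProductBilin_nondegenerate,
    Module.finrank_fintype_fun_eq_card]

theorem dualCode_dualCode (A : Submodule (ZMod 2) (ι → ZMod 2)) : dualCode (dualCode A) = A := by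
  rw [dualCode_eq_orthogonal, dualCode_eq_orthogonal]
  refine LinearMap.BilinForm.orthogonal_orthogonal dotProductBilin_nondegenerate ?_ A
  intro x y h
  exact (dotProduct_comm y x).trans h

end Duality

/-- The CSS code of a binary code that contains its dual. -/
theorem isQuantumCode_cssCode_dualCode {ι : Type*} [Fintype ι] [DecidableEq ι]
    {A : Submodule (ZMod 2) (ι → ZMod 2)}
    (hA : dualCode A ≤ A) {d : ℕ} (hd : ∀ x ∈ A, x ≠ 0 → d ≤ hammingNorm x) :
    IsQuantumCode (cssCode A (dualCode A)) (2 * Module.finrank (ZMod 2) A - Fintype.card ι) d := by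
  refine ⟨?_, fun a b hab => ?_⟩
  · rw [finrank_cssCode hA, finrank_dualCode]
    have := A.finrank_le
    rw [Module.finrank_fintype_fun_eq_card] at this
    congr 1
    omega
  have ha : hammingNorm a < d := lt_of_le_of_lt
    (Finset.card_le_card fun i hi => by simp_all) hab
  have hb : hammingNorm b < d := lt_of_le_of_lt
    (Finset.card_le_card fun i hi => by simp_all) hab
  -- An error escaping both detection lemmas has `a` and `b` in `A`, so at weight below `d` it is
  -- the identity.
  by_cases haA : a ∈ A
  · by_cases hbA : b ∈ A
    · have ha0 : a = 0 := by_contra fun h => (hd a haA h).not_gt ha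
      have hb0 : b = 0 := by_contra fun h => (hd b hbA h).not_gt hb
      subst ha0 hb0
      exact ⟨1, fun φ _ ψ _ => by rw [pauli_zero_zero, one_mul]⟩
    · exact detects_cssCode_of_notMem_dualCode a (by rwa [dualCode_dualCode])
  · exact detects_cssCode_of_notMem hA haA b

/-! ### The ring `R` -/

namespace R

/-- Coordinates with respect to `1, u, u²`. -/
def coordEquiv : R ≃ ZMod 2 × ZMod 2 × ZMod 2 where
  toFun x := (x.a, x.b, x.c)
  invFun p := ⟨p.1, p.2.1, p.2.2⟩
  left_inv _ := rfl
  right_inv _ := rfl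

instance : DecidableEq R := coordEquiv.decidableEq

instance : Fintype R := Fintype.ofEquiv _ coordEquiv.symm

theorem natCard : Nat.card R = 2 ^ 3 := by
  rw [Nat.card_congr coordEquiv]
  simp

theorem natCard_span_singleton (r : R) :
    Nat.card (Ideal.span {r}) = (Finset.univ.image fun x => x * r).card := by
  rw [← Nat.card_eq_finsetCard]
  exact Nat.card_congr (Equiv.subtypeEquivRight fun x => by
    simp [Ideal.mem_span_singleton', eq_comm])

theorem natCard_span_u : Nat.card (Ideal.span {u}) = 2 ^ 2 := by
  rw [natCard_span_singleton]; decide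

theorem natCard_span_one_add_u : Nat.card (Ideal.span {1 + u}) = 2 ^ 2 := by
  rw [natCard_span_singleton]; decide

theorem natCard_span_one_add_u_sq : Nat.card (Ideal.span {1 + u ^ 2}) = 2 ^ 1 := by
  rw [natCard_span_singleton, pow_two]; decide

theorem natCard_span_u_add_u_sq : Nat.card (Ideal.span {u + u ^ 2}) = 2 ^ 1 := by
  rw [natCard_span_singleton, pow_two]; decide

theorem gray_dotProduct_gray (x y : R) : x.gray ⬝ᵥ y.gray = (x * y).c := by
  have h : ∀ a b c a' b' c' : ZMod 2, a * a' + (a + c) * (a' + c') + b * b' =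
      a * c' + b * b' + c * a' + c * c' := by decide
  simpa [gray, dotProduct, Fin.sum_univ_three] using h x.a x.b x.c y.a y.b y.c

theorem sum_c {ι : Type*} (s : Finset ι) (f : ι → R) : (∑ i ∈ s, f i).c = ∑ i ∈ s, (f i).c :=
  map_sum (⟨⟨R.c, rfl⟩, fun _ _ => rfl⟩ : R →+ ZMod 2) f s

/-- The form `x ↦ x.c` generates the dual of `R`. -/
theorem eq_zero_of_forall_mul_c {s : R} (h : ∀ r : R, (r * s).c = 0) : s = 0 := by
  have h1 := h 1
  have h2 := h u
  have h3 := h (u * u)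
  simp [u] at h1 h2 h3
  ext <;> simp_all

theorem gray_injective : Function.Injective gray := by
  intro x y h
  have h0 := congrFun h 0
  have h1 := congrFun h 1
  have h2 := congrFun h 2
  simp only [gray, Matrix.cons_val] at h0 h1 h2
  ext
  · exact h0
  · exact h2
  · rw [h0] at h1; exact add_left_cancel h1

theorem gray_surjective : Function.Surjective gray := by
  intro v
  refine ⟨⟨v 0, v 2, v 0 + v 1⟩, ?_⟩
  ext k
  fin_cases k
  · rfl
  · simp [gray, ← add_assoc, CharTwo.add_self_eq_zero]
  · rfl

end R

/-! ### The Gray map -/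

/-- The index `3 i + k` of the `k`-th bit of the `i`-th block. -/
def grayIndex (n : ℕ) : Fin n × Fin 3 ≃ Fin (3 * n) :=
  finProdFinEquiv.trans (finCongr (mul_comm n 3))

theorem grayMap_grayIndex {n : ℕ} (x : Fin n → R) (i : Fin n) (k : Fin 3) :
    grayMap x (grayIndex n (i, k)) = (x i).gray k := by
  have h1 : (⟨grayIndex n (i, k) / 3, Nat.div_lt_of_lt_mul (grayIndex n (i, k)).isLt⟩ : Fin n)
      = i := by
    ext; simp [grayIndex]; omega
  have h2 : (⟨grayIndex n (i, k) % 3, Nat.mod_lt _ (by norm_num)⟩ : Fin 3) = k := by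
    ext; simp [grayIndex]
  simp only [grayMap, h1, h2]

theorem grayMap_dotProduct {n : ℕ} (x y : Fin n → R) :
    grayMap x ⬝ᵥ grayMap y = (x ⬝ᵥ y).c := by
  simp only [dotProduct, R.sum_c]
  rw [← (grayIndex n).sum_comp, Fintype.sum_prod_type]
  simp only [grayMap_grayIndex]
  exact Finset.sum_congr rfl fun i _ => R.gray_dotProduct_gray (x i) (y i)

theorem hammingNorm_grayMap {n : ℕ} (x : Fin n → R) :
    hammingNorm (grayMap x) = ∑ i, (x i).leeWeight := by
  simp only [R.leeWeight, hammingNorm, Finset.card_filter]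
  rw [← (grayIndex n).sum_comp, Fintype.sum_prod_type]
  simp only [grayMap_grayIndex]

theorem grayMap_injective {n : ℕ} : Function.Injective (grayMap (n := n)) := by
  intro x y h
  funext i
  refine R.gray_injective (funext fun k => ?_)
  rw [← grayMap_grayIndex, ← grayMap_grayIndex, h]

theorem grayMap_surjective {n : ℕ} : Function.Surjective (grayMap (n := n)) := by
  intro v
  choose x hx using fun i => R.gray_surjective fun k => v (grayIndex n (i, k))
  refine ⟨x, funext fun j => ?_⟩
  obtain ⟨⟨i, k⟩, rfl⟩ := (grayIndex n).surjective j
  rw [grayMap_grayIndex, hx]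

theorem dualCode_grayCode {n : ℕ} (C : Submodule R (Fin n → R)) :
    dualCode (grayCode C) = grayCode (dualCode C) := by
  ext v
  obtain ⟨z, rfl⟩ := grayMap_surjective v
  constructor
  · refine fun h => ⟨z, fun y hy => R.eq_zero_of_forall_mul_c fun r => ?_, rfl⟩
    -- Binary orthogonality controls only the `u²`-coefficient; `R`-linearity of `C` supplies it for
    -- every multiple `r • y`.
    rw [← smul_eq_mul, ← dotProduct_smul, ← grayMap_dotProduct]
    exact h _ ⟨r • y, C.smul_mem r hy, rfl⟩
  · rintro ⟨z', hz', he⟩ _ ⟨y, hy, rfl⟩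
    rw [← he, grayMap_dotProduct, hz' y hy]
    rfl

theorem natCard_grayCode {n : ℕ} (C : Submodule R (Fin n → R)) :
    Nat.card (grayCode C) = Nat.card C :=
  Nat.card_image_of_injective grayMap_injective (C : Set (Fin n → R))

theorem HasType.natCard {n : ℕ} {C : Submodule R (Fin n → R)} {k₁ k₂ k₃ k₄ k₅ : ℕ}
    (h : HasType C k₁ k₂ k₃ k₄ k₅) :
    Nat.card C = 2 ^ (3 * k₁ + 2 * (k₂ + k₃) + (k₄ + k₅)) := by
  obtain ⟨e⟩ := h
  rw [Nat.card_congr e.toEquiv]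
  simp only [Nat.card_prod, Nat.card_fun, Nat.card_fin, R.natCard, R.natCard_span_u,
    R.natCard_span_one_add_u, R.natCard_span_one_add_u_sq, R.natCard_span_u_add_u_sq,
    ← pow_mul, ← pow_add]
  congr 1
  ring

theorem HasType.finrank_grayCode {n : ℕ} {C : Submodule R (Fin n → R)} {k₁ k₂ k₃ k₄ k₅ : ℕ}
    (h : HasType C k₁ k₂ k₃ k₄ k₅) :
    Module.finrank (ZMod 2) (grayCode C) = 3 * k₁ + 2 * (k₂ + k₃) + (k₄ + k₅) := by
  have h1 := Module.natCard_eq_pow_finrank (K := ZMod 2) (V := grayCode C)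
  rw [natCard_grayCode, h.natCard, Nat.card_zmod] at h1
  exact (Nat.pow_right_injective le_rfl h1).symm

/-! ### Distance and duality of codes over `R` -/

theorem leeDist_eq_hammingNorm {n : ℕ} (x y : Fin n → R) :
    leeDist x y = hammingNorm (grayMap (x - y)) :=
  (hammingNorm_grayMap (x - y)).symm

theorem minLeeDist_le_hammingNorm {n : ℕ} {C : Submodule R (Fin n → R)}
    {v : Fin (3 * n) → ZMod 2} (hv : v ∈ grayCode C) (h0 : v ≠ 0) :
    minLeeDist C ≤ hammingNorm v := by
  obtain ⟨x, hx, rfl⟩ := hv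
  refine Nat.sInf_le ⟨x, hx, 0, C.zero_mem, ?_, ?_⟩
  · rintro rfl
    exact h0 grayMap_zero
  · rw [leeDist_eq_hammingNorm, sub_zero]

/-- For `C = ⊥` the infimum is over the empty set and takes the default value `0`. -/
theorem one_le_minLeeDist {n : ℕ} {C : Submodule R (Fin n → R)} (hC : C ≠ ⊥) :
    1 ≤ minLeeDist C := by
  obtain ⟨x, hx, hx0⟩ := C.exists_mem_ne_zero_of_ne_bot hC
  obtain ⟨y, hy, z, hz, hyz, hd⟩ : minLeeDist C ∈ {d | ∃ x ∈ C, ∃ y ∈ C, x ≠ y ∧ d = leeDist x y} :=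
    Nat.sInf_mem ⟨_, x, hx, 0, C.zero_mem, hx0, rfl⟩
  rw [hd, leeDist_eq_hammingNorm, Nat.one_le_iff_ne_zero, hammingNorm_ne_zero_iff]
  intro h
  exact hyz (sub_eq_zero.1 (grayMap_injective (h.trans grayMap_zero.symm)))

theorem dualCode_crtCode_le {n : ℕ} {C₂ : Submodule (ZMod 2) (Fin n → ZMod 2)}
    {Cw : Submodule (ZMod 2)[ε] (Fin n → (ZMod 2)[ε])}
    (h₂ : dualCode C₂ ≤ C₂) (hw : dualCode Cw ≤ Cw) :
    dualCode (crtCode C₂ Cw) ≤ crtCode C₂ Cw := by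
  -- The components `y` and `z` vary independently; setting one to zero isolates the other.
  have key : ∀ x ∈ dualCode (crtCode C₂ Cw), ∀ y ∈ C₂, ∀ z ∈ Cw,
      ∑ i, R.crt (x i) * (y i, z i) = 0 := by
    intro x hx y hy z hz
    have hmem : (fun i => R.crt.symm (y i, z i)) ∈ crtCode C₂ Cw := by
      constructor <;> simpa
    have := congrArg R.crt (hx _ hmem)
    simpa [dotProduct, map_sum] using this
  intro x hx
  constructor
  · refine h₂ fun y hy => ?_
    simpa [dotProduct, Prod.fst_sum] using congrArg Prod.fst (key x hx y hy 0 Cw.zero_mem)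
  · refine hw fun z hz => ?_
    simpa [dotProduct, Prod.snd_sum] using congrArg Prod.snd (key x hx 0 C₂.zero_mem z hz)

end CyclicQuantum

theorem theorem10 (n : ℕ) (hn : Odd n)
    (C₂ : Submodule (ZMod 2) (Fin n → ZMod 2))
    (Cw : Submodule (ZMod 2)[ε] (Fin n → (ZMod 2)[ε]))
    (C : Submodule R (Fin n → R)) (hC : C = crtCode C₂ Cw) (hcyc : IsCyclicCode C)
    (k₁ k₂ k₃ k₄ k₅ : ℕ) (htype : HasType C k₁ k₂ k₃ k₄ k₅)
    (h₂ : dualCode C₂ ≤ C₂) (hw : dualCode Cw ≤ Cw) :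
    dualCode C ≤ C ∧
    ∃ K : ℕ, (K : ℤ) = 6 * k₁ + 4 * (k₂ + k₃) + 2 * (k₄ + k₅) - 3 * n ∧
      (dualCode (grayCode C) ≤ grayCode C ∧
        IsQuantumCode (cssCode (grayCode C) (dualCode (grayCode C))) K (minLeeDist C)) ∧
      ∃ Q : Submodule ℂ (Qubits (Fin (3 * n))), IsExactQuantumCode Q K (minLeeDist C) := by
  have hdual : dualCode C ≤ C := hC ▸ dualCode_crtCode_le h₂ hw
  have hgray : dualCode (grayCode C) ≤ grayCode C := by
    rw [dualCode_grayCode]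
    exact Set.image_mono hdual
  have hA := htype.finrank_grayCode
  have hB := finrank_dualCode (grayCode C)
  have hle := Submodule.finrank_mono hgray
  have hcode := isQuantumCode_cssCode_dualCode hgray
    fun x hx h0 => minLeeDist_le_hammingNorm hx h0
  rw [Fintype.card_fin] at hB hcode
  obtain ⟨m, hm⟩ := hn
  refine ⟨hdual, _, ?_, ⟨hgray, hcode⟩, ?_⟩
  -- `A^⊥ ⊆ A` gives `3n ≤ 2 dim A`, so the truncated subtraction in the dimension of the code is
  -- exact.
  · omega
  -- Otherwise `A` would be self-dual and `2 dim A = 3n`, impossible for odd `n`.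
  obtain ⟨x, hxA, hxB⟩ : ∃ x ∈ grayCode C, x ∉ dualCode (grayCode C) := by
    by_contra! h
    have := Submodule.finrank_mono (show grayCode C ≤ dualCode (grayCode C) from h)
    omega
  have hC0 : C ≠ ⊥ := by
    rintro rfl
    obtain ⟨y, hy, rfl⟩ := hxA
    rw [(Submodule.mem_bot R).1 hy, grayMap_zero] at hxB
    exact hxB (Submodule.zero_mem _)
  exact hcode.exists_isExactQuantumCode (one_le_minLeeDist hC0) (not_detects_cssCode hxA hxB)
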